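/- For non-negative integers $a,b$ let $C(a,b)=\frac{(2a)!\,(2b)!}{a!\,(a+b)!\,b!}$. For a permutation $\sigma\in S_N$, with the convention $\sigma(0)=0$, let \[p_+(\sigma)=\#\{1\le i\le N-1 \mid \sigma(i-1)<\sigma(i)>\sigma(i+1)\},\qquad p_-(\sigma)=\#\{2\le i\le N-1 \mid \sigma(i-1)<\sigma(i)>\sigma(i+1)\}.\] For non-negative integers $n,m$ let $S(1_n,1_m)$ be the set of permutations $\sigma\in S_{n+m}$ whose word $\sigma(1)\cdots\sigma(n+m)$ is a shuffle of the words $1\,2\cdots n$ and $(n+1)\cdots(n+m)$, that is, such that $\sigma^{-1}(1)<\cdots<\sigma^{-1}(n)$ and $\sigma^{-1}(n+1)<\cdots<\sigma^{-1}(n+m)$. Then for all non-negative integers $n,m$ \[\sum_{\sigma\in S(1_n,1_m)}(-1)^{p_-(\sigma)}\,C\bigl(p_-(\sigma),\lfloor (n+m)/2\rfloor-p_-(\sigma)\bigr)=\begin{cases}C(0,\lfloor n/2\rfloor)\,C(0,\lfloor m/2\rfloor)&\text{if $n$ or $m$ is even,}\\ 4\,C(0,\lfloor n/2\rfloor)\,C(0,\lfloor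 m/2\rfloor)&\text{if $n$ and $m$ are odd,}\end{cases}\] and, whenever $n$ and $m$ have the same parity, \[\sum_{\sigma\in S(1_n,1_m)}(-1)^{p_+(\sigma)}\,C\bigl(p_+(\sigma),(n+m)/2-p_+(\sigma)\bigr)=\begin{cases}C(0,n/2)\,C(0,m/2)&\text{if $n$ and $m$ are even,}\\ 0&\text{if $n$ and $m$ are odd.}\end{cases}\] -/

import Mathlib

/-- The bivariate Catalan number `C(m,n) = (2m)! (2n)! / (m! (m+n)! n!)`, as a rational number. -/
def bivariateCatalan (m n : ℕ) : ℚ :=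
  ((Nat.factorial (2 * m) : ℚ) * (Nat.factorial (2 * n) : ℚ)) /
    ((Nat.factorial m : ℚ) * (Nat.factorial (m + n) : ℚ) * (Nat.factorial n : ℚ))

/-- The one-line word of a permutation in the usual `1`-based numbering: for `1 ≤ i ≤ N` this is
`σ(i) ∈ {1, …, N}`. The value at `0` is `0` (the convention `σ(0) = 0`); so is the value beyond `N`,
which is never used. -/
def permWord {N : ℕ} (σ : Equiv.Perm (Fin N)) (i : ℕ) : ℕ :=
  if h : 1 ≤ i ∧ i ≤ N then ((σ ⟨i - 1, by omega⟩ : Fin N) : ℕ) + 1 else 0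

/-- The augmented peak set: `{i ∈ [N-1] | σ(i-1) < σ(i) > σ(i+1)}`, where `σ(0) = 0`. -/
def augPeakSet {N : ℕ} (σ : Equiv.Perm (Fin N)) : Finset ℕ :=
  (Finset.Icc 1 (N - 1)).filter fun i =>
    permWord σ (i - 1) < permWord σ i ∧ permWord σ (i + 1) < permWord σ i

/-- The interior peak set: `{i ∈ [N-1] | i ≠ 1, σ(i-1) < σ(i) > σ(i+1)}`. -/
def intPeakSet {N : ℕ} (σ : Equiv.Perm (Fin N)) : Finset ℕ :=
  (Finset.Icc 1 (N - 1)).filter fun i =>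
    i ≠ 1 ∧ permWord σ (i - 1) < permWord σ i ∧ permWord σ (i + 1) < permWord σ i

/-- `p₋(σ)`, the number of interior peaks. -/
def peakMinus {N : ℕ} (σ : Equiv.Perm (Fin N)) : ℕ := (intPeakSet σ).card

/-- `p₊(σ)`, the number of augmented peaks. -/
def peakPlus {N : ℕ} (σ : Equiv.Perm (Fin N)) : ℕ := (augPeakSet σ).card

/-- `S(σ, τ)`: the permutations `ρ` of `n + m` letters whose word `ρ(1) … ρ(n+m)` is a shuffle of
`σ(1) … σ(n)` and `n + τ(1) … n + τ(m)`. That is, the position `ρ⁻¹(σ(i))` of the `i`-th letter of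
the first word increases with `i`, and likewise for the second word. -/
def shuffles {n m : ℕ} (σ : Equiv.Perm (Fin n)) (τ : Equiv.Perm (Fin m)) :
    Finset (Equiv.Perm (Fin (n + m))) :=
  Finset.univ.filter fun ρ =>
    (∀ i j : Fin n, i < j → ρ.symm (Fin.castAdd m (σ i)) < ρ.symm (Fin.castAdd m (σ j))) ∧
    (∀ i j : Fin m, i < j → ρ.symm (Fin.natAdd n (τ i)) < ρ.symm (Fin.natAdd n (τ j)))

/-! Marking the positions of the letters `1, …, n` turns a shuffle into a binary word, and every
such word arises once. A shuffle descends exactly at the factors `false, true`. The step just before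
a descent is never itself a descent, so augmented peaks are the descents of the word, and interior
peaks are those not starting at its first letter. There are `n.choose k * m.choose k` words with `k`
descents, so the `p₊` sum is `chooseSum n m`. Deleting the first letter gives the `p₋` sum as
`chooseSum (n - 1) m + chooseSum n (m - 1)` when `n` and `m` are positive.

With the alternating Catalan weight, `chooseSum` is a terminating Watson sum. A recurrence in steps
of two (`chooseSum_catalanWeight_succ_succ`) evaluates it as a product for even `n, m` and as zero
for odd `n, m`. If the parities differ, one term of the `p₋` sum vanishes and the other is a
product. If they agree, both terms fall outside these evaluations, and
`chooseSum_succ_add_chooseSum_succ` rewrites their sum through cases that are covered. -/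

/-! ### Recurrences for the bivariate Catalan numbers -/

theorem bivariateCatalan_succ_mul (a b : ℕ) :
    (2 * b + 1) * bivariateCatalan (a + 1) b = (2 * a + 1) * bivariateCatalan a (b + 1) := by
  unfold bivariateCatalan
  have ha := Nat.cast_ne_zero (R := ℚ).2 a.factorial_ne_zero
  have hb := Nat.cast_ne_zero (R := ℚ).2 b.factorial_ne_zero
  have hab := Nat.cast_ne_zero (R := ℚ).2 (a + b + 1).factorial_ne_zero
  rw [show 2 * (a + 1) = 2 * a + 1 + 1 by ring, show 2 * (b + 1) = 2 * b + 1 + 1 by ring,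
    show a + 1 + b = a + b + 1 by ring, show a + (b + 1) = a + b + 1 by ring]
  simp only [Nat.factorial_succ (2 * a + 1), Nat.factorial_succ (2 * a), Nat.factorial_succ a,
    Nat.factorial_succ (2 * b + 1), Nat.factorial_succ (2 * b), Nat.factorial_succ b]
  push_cast
  field_simp
  ring

theorem bivariateCatalan_succ_right_mul (a b : ℕ) :
    (a + b + 1) * bivariateCatalan a (b + 1) = 2 * (2 * b + 1) * bivariateCatalan a b := by
  unfold bivariateCatalan
  have ha := Nat.cast_ne_zero (R := ℚ).2 a.factorial_ne_zero
  have hb := Nat.cast_ne_zero (R := ℚ).2 b.factorial_ne_zero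
  have hab := Nat.cast_ne_zero (R := ℚ).2 (a + b).factorial_ne_zero
  rw [show 2 * (b + 1) = 2 * b + 1 + 1 by ring, show a + (b + 1) = a + b + 1 by ring]
  simp only [Nat.factorial_succ (2 * b + 1), Nat.factorial_succ (2 * b), Nat.factorial_succ b,
    Nat.factorial_succ (a + b)]
  push_cast
  field_simp
  ring

theorem bivariateCatalan_succ_add_succ (a b : ℕ) :
    bivariateCatalan (a + 1) b + bivariateCatalan a (b + 1) = 4 * bivariateCatalan a b := by
  have h1 := bivariateCatalan_succ_mul a b
  have h2 := bivariateCatalan_succ_right_mul a b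
  have h : ((2 * b + 1) * (a + b + 1) : ℚ) ≠ 0 := by positivity
  apply mul_left_cancel₀ h
  linear_combination (a + b + 1 : ℚ) * h1 + (2 * a + 1 + (2 * b + 1) : ℚ) * h2

theorem bivariateCatalan_zero_zero : bivariateCatalan 0 0 = 1 := by
  simp [bivariateCatalan]

/-- The alternating weight `(-1)ᵏ C(k, M - k)`. -/
def catalanWeight (M k : ℕ) : ℚ := (-1) ^ k * bivariateCatalan k (M - k)

theorem catalanWeight_sub_succ {M k : ℕ} (h : k ≤ M) :
    catalanWeight (M + 1) k - catalanWeight (M + 1) (k + 1) = 4 * catalanWeight M k := by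
  obtain ⟨b, rfl⟩ := Nat.exists_eq_add_of_le h
  have := bivariateCatalan_succ_add_succ k b
  simp only [catalanWeight, show k + b + 1 - k = b + 1 by omega,
    show k + b + 1 - (k + 1) = b by omega, show k + b - k = b by omega, pow_succ]
  linear_combination (-1 : ℚ) ^ k * this

theorem catalanWeight_succ_mul {M k : ℕ} (h : k ≤ M) :
    (2 * M + 1 - 2 * k) * catalanWeight (M + 1) (k + 1)
      = -((2 * k + 1) * catalanWeight (M + 1) k) := by
  obtain ⟨b, rfl⟩ := Nat.exists_eq_add_of_le h
  have := bivariateCatalan_succ_mul k b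
  simp only [catalanWeight, show k + b + 1 - k = b + 1 by omega,
    show k + b + 1 - (k + 1) = b by omega, pow_succ]
  push_cast
  linear_combination -(-1 : ℚ) ^ k * this

/-! ### Evaluation of the Watson sum -/

/-- The sum of `φ` over the binary words with `n` and `m` letters of the two kinds, graded by their
number of descents. -/
def chooseSum (n m : ℕ) (φ : ℕ → ℚ) : ℚ :=
  ∑ k ∈ Finset.range (m + 1), (n.choose k : ℚ) * m.choose k * φ k

theorem chooseSum_eq_sum_range {n m K : ℕ} (h : m < K) (φ : ℕ → ℚ) :
    chooseSum n m φ = ∑ k ∈ Finset.range K, (n.choose k : ℚ) * m.choose k * φ k := by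
  unfold chooseSum
  apply Finset.sum_subset
  · intro k; simp only [Finset.mem_range]; omega
  · intro k _ hk
    rw [Nat.choose_eq_zero_of_lt (n := m) (by simpa using hk)]; simp

theorem chooseSum_zero_left (m : ℕ) (φ : ℕ → ℚ) : chooseSum 0 m φ = φ 0 := by
  unfold chooseSum
  rw [Finset.sum_range_succ']
  simp

theorem chooseSum_zero_right (n : ℕ) (φ : ℕ → ℚ) : chooseSum n 0 φ = φ 0 := by
  simp [chooseSum]

theorem chooseSum_one_left (m : ℕ) (φ : ℕ → ℚ) : chooseSum 1 m φ = φ 0 + m * φ 1 := by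
  rw [chooseSum_eq_sum_range (show m < m + 2 by omega), Finset.sum_range_succ',
    Finset.sum_range_succ']
  simp [Nat.choose_eq_zero_of_lt]
  ring

/-- The Zeilberger recurrence of the terminating Watson sum. -/
theorem chooseSum_catalanWeight_succ_succ {n m M : ℕ} (h : n + m = 2 * M) :
    (n + 2) * chooseSum (n + 2) m (catalanWeight (M + 1))
      = 4 * (n + 1) * chooseSum n m (catalanWeight M) := by
  -- Creative telescoping with certificate `G k = -k * (n+1).choose (k-1) * m.choose k *
  -- catalanWeight (M+1) k`. It vanishes at `k = 0` by its first factor, which also makes the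
  -- truncated `k - 1` harmless, and at `k = m + 1` by `m.choose k`.
  have key : ∀ k ∈ Finset.range (m + 1),
      (n + 2) * (((n + 2).choose k : ℚ) * m.choose k * catalanWeight (M + 1) k)
        - 4 * (n + 1) * ((n.choose k : ℚ) * m.choose k * catalanWeight M k)
      = (-((k + 1 : ℕ) * (n + 1).choose (k + 1 - 1) * m.choose (k + 1)
          * catalanWeight (M + 1) (k + 1)))
        - (-((k : ℕ) * (n + 1).choose (k - 1) * m.choose k * catalanWeight (M + 1) k)) := by
    intro k hk
    have hm : ((k : ℚ) + 1) * m.choose (k + 1) = (m - k) * m.choose k := by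
      have := Nat.choose_succ_right_eq m k
      have hk' : k ≤ m := by simpa [Nat.lt_succ_iff] using hk
      rw [← Nat.cast_sub hk']
      exact_mod_cast (by linarith)
    have hn : ((n : ℚ) + 1) * n.choose k = (n + 1 - k) * (n + 1).choose k := by
      rcases le_or_gt k n with hkn | hkn
      · have h2 := Nat.choose_mul_succ_eq n k
        have h3 : ((n + 1 - k : ℕ) : ℚ) = n + 1 - k := by
          rw [Nat.cast_sub (by omega)]; push_cast; ring
        rw [← h3]
        exact_mod_cast (by linarith)
      · rcases Nat.lt_or_ge (n + 1) k with h' | h'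
        · rw [Nat.choose_eq_zero_of_lt hkn, Nat.choose_eq_zero_of_lt h']; simp
        · have : k = n + 1 := by omega
          subst this
          rw [Nat.choose_eq_zero_of_lt hkn]; push_cast; ring
    have hp : ((n : ℚ) + 2) * (n + 2).choose k - k * (n + 1).choose (k - 1)
        = (n + 2 + k) * (n + 1).choose k := by
      cases k with
      | zero => simp
      | succ j =>
        have h1 := Nat.choose_succ_right_eq (n + 1) j
        rw [Nat.choose_succ_succ (n + 1) j]
        rcases le_or_gt j (n + 1) with hj | hj
        · have h2 : ((n + 1).choose (j + 1) : ℚ) * (j + 1) = (n + 1).choose j * (n + 1 - j) := by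
            have h3 : ((n + 1 - j : ℕ) : ℚ) = n + 1 - j := by
              rw [Nat.cast_sub hj]; push_cast; ring
            rw [← h3]; exact_mod_cast h1
          push_cast
          linear_combination -h2
        · rw [Nat.choose_eq_zero_of_lt hj, Nat.choose_eq_zero_of_lt (show n + 1 < j + 1 by omega)]
          simp [Nat.choose_eq_zero_of_lt hj]
    have hMq : (n : ℚ) + m = 2 * M := by exact_mod_cast h
    rw [Nat.add_sub_cancel]
    push_cast
    rcases le_or_gt k M with hkM | hkM
    · have e1 := catalanWeight_sub_succ hkM
      have e2 := catalanWeight_succ_mul hkM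
      linear_combination (m.choose k * catalanWeight (M + 1) k : ℚ) * hp
        + ((n : ℚ) + 1) * n.choose k * m.choose k * e1
        + (n + 1).choose k * catalanWeight (M + 1) (k + 1) * hm
        - m.choose k * (catalanWeight (M + 1) k - catalanWeight (M + 1) (k + 1)) * hn
        + (m.choose k : ℚ) * (n + 1).choose k * e2
        + (m.choose k : ℚ) * (n + 1).choose k * catalanWeight (M + 1) (k + 1) * hMq
    -- Beyond `M` the subtraction `M - k` truncates and the weight identities are unavailable, but
    -- `M < k ≤ m` forces `n + 1 < k + 1`, indeed `n + 1 ≤ M`, so the binomials in `n` and `n + 1`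
    -- vanish.
    · have hk' : k ≤ m := by simpa [Nat.lt_succ_iff] using hk
      have z1 : n.choose k = 0 := Nat.choose_eq_zero_of_lt (by omega)
      have z2 : (n + 1).choose k = 0 := Nat.choose_eq_zero_of_lt (by omega)
      rw [z1, z2]
      rw [z2] at hp
      push_cast at hp ⊢
      linear_combination (m.choose k * catalanWeight (M + 1) k : ℚ) * hp
  have hs := Finset.sum_congr rfl key
  rw [Finset.sum_range_sub (fun k => -((k : ℕ) * ((n + 1).choose (k - 1) : ℚ) * m.choose k
    * catalanWeight (M + 1) k)), Finset.sum_sub_distrib, ← Finset.mul_sum, ← Finset.mul_sum] at hs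
  unfold chooseSum
  simp at hs
  linear_combination hs

theorem chooseSum_catalanWeight_even (p q : ℕ) :
    chooseSum (2 * p) (2 * q) (catalanWeight (p + q))
      = bivariateCatalan 0 p * bivariateCatalan 0 q := by
  induction p with
  | zero => simp [chooseSum_zero_left, catalanWeight, bivariateCatalan_zero_zero]
  | succ p ih =>
    have h := chooseSum_catalanWeight_succ_succ (n := 2 * p) (m := 2 * q) (M := p + q) (by ring)
    have h2 := bivariateCatalan_succ_right_mul 0 p
    rw [ih] at h
    rw [show 2 * (p + 1) = 2 * p + 2 by ring, show p + 1 + q = p + q + 1 by ring]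
    push_cast at h h2
    have h3 : (2 * p + 2 : ℚ) ≠ 0 := by positivity
    apply mul_left_cancel₀ h3
    linear_combination h - 2 * bivariateCatalan 0 q * h2

theorem chooseSum_catalanWeight_odd (p q : ℕ) :
    chooseSum (2 * p + 1) (2 * q + 1) (catalanWeight (p + q + 1)) = 0 := by
  induction p with
  | zero =>
    -- For `n = 1` only the terms `k = 0, 1` survive, and the ratio of consecutive weights makes
    -- them cancel.
    have h := catalanWeight_succ_mul (Nat.zero_le q)
    rw [chooseSum_one_left]
    push_cast at h ⊢
    simp only [zero_add] at h ⊢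
    linear_combination h
  | succ p ih =>
    have h := chooseSum_catalanWeight_succ_succ (n := 2 * p + 1) (m := 2 * q + 1)
      (M := p + q + 1) (by ring)
    rw [ih, mul_zero] at h
    have h3 : ((2 * p + 1 : ℕ) + 2 : ℚ) ≠ 0 := by positivity
    rw [show 2 * (p + 1) + 1 = 2 * p + 1 + 2 by ring, show p + 1 + q + 1 = p + q + 1 + 1 by ring]
    exact (mul_eq_zero.1 h).resolve_left h3

/-- Pascal's rule in both binomials, compared coefficientwise at `φ (k + 1)`. The leftover
differences `φ k - φ (k + 1)` collapse to four times the weight of level `M`. -/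
theorem chooseSum_succ_add_chooseSum_succ {n m M : ℕ} (h : n + m = 2 * M) :
    chooseSum n (m + 1) (catalanWeight (M + 1)) + chooseSum (n + 1) m (catalanWeight (M + 1))
      = chooseSum (n + 1) (m + 1) (catalanWeight (M + 1))
        + 4 * chooseSum n m (catalanWeight M) := by
  set φ := catalanWeight (M + 1) with hφ
  have h4 : 4 * chooseSum n m (catalanWeight M)
      = ∑ k ∈ Finset.range (m + 1), (n.choose k : ℚ) * m.choose k * (φ k - φ (k + 1)) := by
    unfold chooseSum
    rw [Finset.mul_sum]
    refine Finset.sum_congr rfl fun k hk => ?_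
    rcases le_or_gt k M with hkM | hkM
    · rw [hφ, catalanWeight_sub_succ hkM]; ring
    · have hk' : k ≤ m := by simpa [Nat.lt_succ_iff] using hk
      rw [Nat.choose_eq_zero_of_lt (show n < k by omega)]; simp
  have h5 : ∑ k ∈ Finset.range (m + 1), (n.choose k : ℚ) * m.choose k * (φ k - φ (k + 1))
      = chooseSum n m φ
        - ∑ k ∈ Finset.range (m + 1), (n.choose k : ℚ) * m.choose k * φ (k + 1) := by
    unfold chooseSum
    rw [← Finset.sum_sub_distrib]
    exact Finset.sum_congr rfl fun k _ => by ring
  have hs : ∀ a b, b ≤ m + 1 → chooseSum a b φ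
      = ∑ k ∈ Finset.range (m + 1), (a.choose (k + 1) : ℚ) * b.choose (k + 1) * φ (k + 1)
        + φ 0 := by
    intro a b hb
    rw [chooseSum_eq_sum_range (show b < m + 1 + 1 by omega), Finset.sum_range_succ']
    simp
  rw [h4, h5, hs _ _ le_rfl, hs _ _ le_rfl, hs _ m (by omega), hs _ m (by omega),
    ← sub_eq_zero]
  have : ∀ a b c d e f : ℚ, a + f + (b + f) - (c + f + (d + f - e)) = a + b + e - (c + d) := by
    intros; ring
  rw [this, ← Finset.sum_add_distrib, ← Finset.sum_add_distrib, ← Finset.sum_add_distrib,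
    sub_eq_zero]
  refine Finset.sum_congr rfl fun k _ => ?_
  simp only [Nat.choose_succ_succ n k, Nat.choose_succ_succ m k]
  push_cast
  ring

/-! ### Binary words counted by descents -/

/-- The number of descents of a binary word, that is of factors `false, true`. -/
def descents {N : ℕ} (f : Fin N → Bool) : ℕ :=
  (Finset.univ.filter fun i : Fin N =>
    f i = false ∧ ∃ h : (i : ℕ) + 1 < N, f ⟨i + 1, h⟩ = true).card

/-- The binary words of length `N` with `n` letters `true`. -/
def binaryWords (N n : ℕ) : Finset (Fin N → Bool) :=
  Finset.univ.filter fun f => (Finset.univ.filter fun i => f i = true).card = n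

theorem descents_cons_true {N : ℕ} (f : Fin N → Bool) :
    descents (Fin.cons true f : Fin (N + 1) → Bool) = descents f := by
  unfold descents
  rw [Fin.card_filter_univ_succ']
  simp only [Fin.cons_zero, Fin.cons_succ, Bool.true_eq_false, false_and, if_false, zero_add]
  congr 1
  ext i
  simp only [Finset.mem_filter, Finset.mem_univ, true_and]
  refine and_congr_right fun _ => ⟨?_, ?_⟩
  · rintro ⟨h, h'⟩; exact ⟨by simpa using h, h'⟩
  · rintro ⟨h, h'⟩; exact ⟨by simpa using h, h'⟩

theorem descents_cons_cons {N : ℕ} (b c : Bool) (f : Fin N → Bool) :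
    descents (Fin.cons b (Fin.cons c f : Fin (N + 1) → Bool) : Fin (N + 2) → Bool)
      = (if b = false ∧ c = true then 1 else 0)
        + descents (Fin.cons c f : Fin (N + 1) → Bool) := by
  -- An extra leading `true` gives both words the same length, so that splitting off position `0`
  -- leaves matching counts.
  rw [← descents_cons_true (Fin.cons c f : Fin (N + 1) → Bool)]
  unfold descents
  rw [Fin.card_filter_univ_succ', Fin.card_filter_univ_succ' (n := N + 1)]
  simp only [Fin.cons_zero, Bool.true_eq_false, false_and, if_false, zero_add]
  congr 1
  refine if_congr (and_congr_right fun _ => ⟨?_, ?_⟩) rfl rfl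
  · rintro ⟨h, h'⟩; exact h'
  · intro h
    have h1 : ((0 : Fin (N + 2)) : ℕ) + 1 < N + 1 + 1 := by simp
    exact ⟨h1, h⟩

theorem descents_eq_zero_of_le_one {N : ℕ} (hN : N ≤ 1) (f : Fin N → Bool) : descents f = 0 := by
  unfold descents
  rw [Finset.card_eq_zero, Finset.filter_eq_empty_iff]
  rintro i - ⟨-, h, -⟩
  omega

theorem binaryWords_eq_empty {N n : ℕ} (h : N < n) : binaryWords N n = ∅ := by
  rw [binaryWords, Finset.filter_eq_empty_iff]
  intro f _ hf
  have := Finset.card_filter_le (Finset.univ : Finset (Fin N)) (fun i => f i = true)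
  rw [Finset.card_univ, Fintype.card_fin] at this
  omega

theorem sum_binaryWords_succ (N n : ℕ) (g : (Fin (N + 1) → Bool) → ℚ) :
    ∑ f ∈ binaryWords (N + 1) n, g f
      = (if n = 0 then 0 else ∑ f ∈ binaryWords N (n - 1), g (Fin.cons true f))
        + ∑ f ∈ binaryWords N n, g (Fin.cons false f) := by
  unfold binaryWords
  rw [Finset.sum_filter, ← Equiv.sum_comp (Fin.consEquiv fun _ => Bool), Fintype.sum_prod_type,
    Fintype.sum_bool]
  congr 1
  · split_ifs with h
    · refine Finset.sum_eq_zero fun f _ => if_neg ?_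
      rw [Fin.card_filter_univ_succ']
      simp [Fin.consEquiv]; omega
    · rw [Finset.sum_filter]
      refine Finset.sum_congr rfl fun f _ => if_congr ?_ rfl rfl
      rw [Fin.card_filter_univ_succ']
      simp [Fin.consEquiv]; omega
  · rw [Finset.sum_filter]
    refine Finset.sum_congr rfl fun f _ => if_congr ?_ rfl rfl
    rw [Fin.card_filter_univ_succ']
    simp [Fin.consEquiv]

theorem binaryWords_zero_zero : binaryWords 0 0 = Finset.univ := by
  simp [binaryWords]

/-- The two leading letters are treated together because each recursion calls the other. A leading
`false` gives `m + 1` letters `false`: with `k + 1` descents, the `n` letters `true` form `k + 1`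
blocks, while the `false` letters form `k + 1` or `k + 2`, whence `m.choose k + m.choose (k + 1)`.
-/
theorem sum_binaryWords_cons (N : ℕ) : ∀ n m : ℕ, n + m = N → ∀ φ : ℕ → ℚ,
    ∑ f ∈ binaryWords N n, φ (descents (Fin.cons true f : Fin (N + 1) → Bool))
      = chooseSum n m φ ∧
    ∑ f ∈ binaryWords N n, φ (descents (Fin.cons false f : Fin (N + 1) → Bool))
      = if n = 0 then φ 0 else ∑ k ∈ Finset.range (m + 1),
          ((n - 1).choose k : ℚ) * (m + 1).choose (k + 1) * φ (k + 1) := by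
  induction N with
  | zero =>
    intro n m h φ
    obtain ⟨rfl, rfl⟩ : n = 0 ∧ m = 0 := by omega
    simp [binaryWords_zero_zero, descents_eq_zero_of_le_one, chooseSum]
  | succ N ih =>
    intro n m h φ
    rw [sum_binaryWords_succ, sum_binaryWords_succ]
    simp only [descents_cons_cons, Bool.true_eq_false, false_and, if_false, and_self, if_true,
      zero_add, Bool.false_eq_true, and_false]
    rcases n with _ | n
    · obtain ⟨m, rfl⟩ : ∃ m', m = m' + 1 := ⟨m - 1, by omega⟩
      simp only [if_true, zero_add, chooseSum_zero_left]
      rw [(ih 0 m (by omega) φ).2]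
      simp
    · simp only [Nat.succ_ne_zero, if_false, Nat.add_sub_cancel]
      -- `φ` stays general because the prefix `false, true` adds a descent and shifts it to `φ (1 +
      -- k)`.
      have hT := fun φ => (ih n m (by omega) φ).1
      rw [hT, hT fun k => φ (1 + k)]
      rcases m with _ | m
      · rw [binaryWords_eq_empty (show N < n + 1 by omega)]
        simp [chooseSum]
      · rw [(ih (n + 1) m (by omega) φ).2]
        simp only [Nat.succ_ne_zero, if_false, Nat.add_sub_cancel]
        constructor
        · unfold chooseSum
          rw [Finset.sum_range_succ', Finset.sum_range_succ' _ (m + 1), add_right_comm,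
            ← Finset.sum_add_distrib]
          congr 1
          · refine Finset.sum_congr rfl fun k _ => ?_
            rw [Nat.choose_succ_succ n k]
            push_cast
            ring
          · simp
        · unfold chooseSum
          rw [Finset.sum_subset (Finset.range_subset_range.2 (show m + 1 ≤ m + 1 + 1 by omega)),
            ← Finset.sum_add_distrib]
          · refine Finset.sum_congr rfl fun k _ => ?_
            simp only [Nat.choose_succ_succ (m + 1) k, add_comm 1 k]
            push_cast
            ring
          · intro k _ hk
            rw [Nat.choose_eq_zero_of_lt (n := m + 1) (by simpa using hk)]
            simp

theorem sum_binaryWords_descents (n m : ℕ) (φ : ℕ → ℚ) :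
    ∑ f ∈ binaryWords (n + m) n, φ (descents f) = chooseSum n m φ := by
  rw [← (sum_binaryWords_cons (n + m) n m rfl φ).1]
  simp only [descents_cons_true]

/-- The number of descents of a binary word that do not start at its first letter. -/
def interiorDescents {N : ℕ} (f : Fin N → Bool) : ℕ :=
  (Finset.univ.filter fun i : Fin N =>
    (i : ℕ) ≠ 0 ∧ f i = false ∧ ∃ h : (i : ℕ) + 1 < N, f ⟨i + 1, h⟩ = true).card

theorem interiorDescents_cons {N : ℕ} (b : Bool) (f : Fin N → Bool) :
    interiorDescents (Fin.cons b f : Fin (N + 1) → Bool) = descents f := by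
  rw [← descents_cons_true f]
  unfold descents interiorDescents
  rw [Fin.card_filter_univ_succ', Fin.card_filter_univ_succ' (n := N)]
  simp only [Fin.cons_zero, Bool.true_eq_false, false_and, if_false, zero_add, Fin.val_zero,
    ne_eq, not_true_eq_false, Fin.cons_succ, Fin.val_succ, Nat.succ_ne_zero, not_false_eq_true,
    true_and]
  congr 1

theorem sum_binaryWords_interiorDescents {N n m : ℕ} (h : n + m = N) (φ : ℕ → ℚ) :
    ∑ f ∈ binaryWords N n, φ (interiorDescents f)
      = if n = 0 then φ 0 else if m = 0 then φ 0 else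
        chooseSum (n - 1) m φ + chooseSum n (m - 1) φ := by
  rcases N with _ | N
  · obtain ⟨rfl, rfl⟩ : n = 0 ∧ m = 0 := by omega
    simp [binaryWords_zero_zero, interiorDescents]
  · rw [sum_binaryWords_succ]
    simp only [interiorDescents_cons]
    rcases n with _ | n
    · obtain rfl : N = 0 + (m - 1) := by omega
      rw [sum_binaryWords_descents]
      simp [chooseSum_zero_left]
    · rw [if_neg n.succ_ne_zero, if_neg n.succ_ne_zero, Nat.add_sub_cancel]
      obtain rfl : N = n + m := by omega
      rw [sum_binaryWords_descents]
      rcases m with _ | m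
      · rw [binaryWords_eq_empty (by omega)]
        simp [chooseSum_zero_right]
      · rw [if_neg m.succ_ne_zero, Nat.add_sub_cancel, show n + (m + 1) = n + 1 + m by ring,
          sum_binaryWords_descents]

/-! ### Shuffles as binary words -/

/-- The binary word of `ρ`, marking the positions of the letters `1, …, n`. -/
def shuffleWord {N : ℕ} (n : ℕ) (ρ : Equiv.Perm (Fin N)) (i : Fin N) : Bool :=
  decide ((ρ i : ℕ) < n)

theorem mem_shuffles_one {n m : ℕ} (ρ : Equiv.Perm (Fin (n + m))) :
    ρ ∈ shuffles (1 : Equiv.Perm (Fin n)) (1 : Equiv.Perm (Fin m)) ↔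
      StrictMono (fun i : Fin n => ρ.symm (Fin.castAdd m i)) ∧
      StrictMono (fun i : Fin m => ρ.symm (Fin.natAdd n i)) := by
  unfold shuffles
  rw [Finset.mem_filter]
  simp [StrictMono]

theorem lt_of_mem_shuffles_one {n m : ℕ} {ρ : Equiv.Perm (Fin (n + m))}
    (hρ : ρ ∈ shuffles (1 : Equiv.Perm (Fin n)) (1 : Equiv.Perm (Fin m))) {i j : Fin (n + m)}
    (hij : i < j) (hw : shuffleWord n ρ i = shuffleWord n ρ j) : ρ i < ρ j := by
  rw [mem_shuffles_one] at hρ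
  obtain ⟨a, rfl⟩ := ρ.symm.surjective i
  obtain ⟨b, rfl⟩ := ρ.symm.surjective j
  rw [Equiv.apply_symm_apply, Equiv.apply_symm_apply]
  simp only [shuffleWord, Equiv.apply_symm_apply, decide_eq_decide] at hw
  induction a using Fin.addCases with
  | left a =>
    induction b using Fin.addCases with
    | left b => exact hρ.1.lt_iff_lt.1 hij
    | right b => simp at hw
  | right a =>
    induction b using Fin.addCases with
    | left b => simp at hw
    | right b =>
      have := hρ.2.lt_iff_lt.1 hij
      simpa using this

theorem apply_succ_lt_iff {n m : ℕ} {ρ : Equiv.Perm (Fin (n + m))}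
    (hρ : ρ ∈ shuffles (1 : Equiv.Perm (Fin n)) (1 : Equiv.Perm (Fin m))) {i j : Fin (n + m)}
    (hij : i < j) : ρ j < ρ i ↔ shuffleWord n ρ i = false ∧ shuffleWord n ρ j = true := by
  constructor
  · intro h
    have hne : shuffleWord n ρ i ≠ shuffleWord n ρ j := fun hw =>
      lt_asymm h (lt_of_mem_shuffles_one hρ hij hw)
    simp only [shuffleWord, ne_eq, decide_eq_decide, decide_eq_false_iff_not, decide_eq_true_eq,
      Fin.lt_def] at *
    omega
  · simp only [shuffleWord, decide_eq_false_iff_not, decide_eq_true_eq, Fin.lt_def]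
    omega

theorem shuffleWord_mem_binaryWords {n m : ℕ} (ρ : Equiv.Perm (Fin (n + m))) :
    shuffleWord n ρ ∈ binaryWords (n + m) n := by
  simp only [binaryWords, Finset.mem_filter, Finset.mem_univ, true_and, shuffleWord,
    decide_eq_true_eq]
  have : (Finset.univ.filter fun i => (ρ i : ℕ) < n)
      = (Finset.univ : Finset (Fin n)).map
        ((Fin.castAddEmb m).trans ρ.symm.toEmbedding) := by
    ext i
    simp only [Finset.mem_filter, Finset.mem_univ, true_and, Finset.mem_map]
    constructor
    · intro h
      exact ⟨⟨ρ i, h⟩, ρ.symm_apply_eq.2 rfl⟩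
    · rintro ⟨a, rfl⟩
      simp
  rw [this]
  simp

/-- The word gives the set of positions of each of the two increasing runs, and a strictly monotone
map is determined by its range. -/
theorem shuffleWord_injOn (n m : ℕ) :
    Set.InjOn (shuffleWord n)
      (shuffles (1 : Equiv.Perm (Fin n)) (1 : Equiv.Perm (Fin m)) :
        Set (Equiv.Perm (Fin (n + m)))) := by
  intro ρ hρ τ hτ h
  rw [Finset.mem_coe, mem_shuffles_one] at hρ hτ
  have r1 : ∀ ρ : Equiv.Perm (Fin (n + m)), Set.range (fun i : Fin n => ρ.symm (Fin.castAdd m i))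
      = {i | shuffleWord n ρ i = true} := by
    intro ρ
    ext i
    simp only [Set.mem_range, Set.mem_ofPred_eq, shuffleWord, decide_eq_true_eq,
      Equiv.symm_apply_eq]
    constructor
    · rintro ⟨a, ha⟩; simp [← ha]
    · intro hi; exact ⟨⟨ρ i, hi⟩, rfl⟩
  have r2 : ∀ ρ : Equiv.Perm (Fin (n + m)), Set.range (fun i : Fin m => ρ.symm (Fin.natAdd n i))
      = {i | shuffleWord n ρ i = false} := by
    intro ρ
    ext i
    simp only [Set.mem_range, Set.mem_ofPred_eq, shuffleWord, decide_eq_false_iff_not,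
      Equiv.symm_apply_eq]
    constructor
    · rintro ⟨a, ha⟩; simp [← ha]
    · intro hi; exact ⟨⟨ρ i - n, by omega⟩, by ext; simp; omega⟩
  have e1 := (hρ.1.range_inj hτ.1).1 (by rw [r1, r1, h])
  have e2 := (hρ.2.range_inj hτ.2).1 (by rw [r2, r2, h])
  apply Equiv.symm_bijective.injective
  ext a
  induction a using Fin.addCases with
  | left a => exact congrArg Fin.val (congrFun e1 a)
  | right a => exact congrArg Fin.val (congrFun e2 a)

theorem exists_mem_shuffles_one {n m : ℕ} {f : Fin (n + m) → Bool}
    (hf : f ∈ binaryWords (n + m) n) :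
    ∃ ρ ∈ shuffles (1 : Equiv.Perm (Fin n)) (1 : Equiv.Perm (Fin m)), shuffleWord n ρ = f := by
  simp only [binaryWords, Finset.mem_filter, Finset.mem_univ, true_and] at hf
  set s : Finset (Fin (n + m)) := Finset.univ.filter fun i => f i = true with hs
  have hc : (sᶜ).card = m := by rw [Finset.card_compl, hf, Fintype.card_fin]; omega
  -- The inverse shuffle: it enumerates the `true` positions increasingly, then the `false` ones.
  let e : Equiv.Perm (Fin (n + m)) := finSumFinEquiv.symm.trans (finSumEquivOfFinset hf hc)
  have e1 : ∀ i, e (Fin.castAdd m i) = s.orderEmbOfFin hf i := fun i => by simp [e]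
  have e2 : ∀ i, e (Fin.natAdd n i) = sᶜ.orderEmbOfFin hc i := fun i => by simp [e]
  refine ⟨e.symm, (mem_shuffles_one _).2 ⟨?_, ?_⟩, ?_⟩
  · simpa [e1] using (s.orderEmbOfFin hf).strictMono
  · simpa [e2] using (sᶜ.orderEmbOfFin hc).strictMono
  · funext i
    obtain ⟨a, rfl⟩ := e.surjective i
    unfold shuffleWord
    rw [Equiv.symm_apply_apply]
    induction a using Fin.addCases with
    | left a =>
      have := s.orderEmbOfFin_mem hf a
      rw [← e1, hs, Finset.mem_filter] at this
      simp [this.2]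
    | right a =>
      have := sᶜ.orderEmbOfFin_mem hc a
      rw [← e2, hs, Finset.mem_compl, Finset.mem_filter] at this
      simpa using this

theorem sum_shuffles_one (n m : ℕ) (g : (Fin (n + m) → Bool) → ℚ) :
    ∑ ρ ∈ shuffles (1 : Equiv.Perm (Fin n)) (1 : Equiv.Perm (Fin m)), g (shuffleWord n ρ)
      = ∑ f ∈ binaryWords (n + m) n, g f :=
  Finset.sum_nbij (shuffleWord n) (fun ρ _ => shuffleWord_mem_binaryWords ρ)
    (shuffleWord_injOn n m)
    (fun _ hf => exists_mem_shuffles_one (Finset.mem_coe.1 hf))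
    fun _ _ => rfl

/-! ### Peaks as descents of the word -/

theorem permWord_succ {N : ℕ} (σ : Equiv.Perm (Fin N)) (i : Fin N) :
    permWord σ ((i : ℕ) + 1) = (σ i : ℕ) + 1 := by
  have := i.isLt
  unfold permWord
  rw [dif_pos ⟨by omega, by omega⟩]
  rfl

/-- The rise before a descent is automatic: at the first letter by the convention `σ(0) = 0`, and
elsewhere because a preceding descent would force `true` at `i`, where a descent needs `false`. -/
theorem permWord_peak_iff {n m : ℕ} {ρ : Equiv.Perm (Fin (n + m))}
    (hρ : ρ ∈ shuffles (1 : Equiv.Perm (Fin n)) (1 : Equiv.Perm (Fin m))) (i : Fin (n + m))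
    (hi : (i : ℕ) + 1 < n + m) :
    (permWord ρ i < permWord ρ (i + 1) ∧ permWord ρ (i + 1 + 1) < permWord ρ (i + 1)) ↔
      shuffleWord n ρ i = false ∧ shuffleWord n ρ ⟨i + 1, hi⟩ = true := by
  have hs := permWord_succ ρ ⟨i + 1, hi⟩
  have hlt : i < ⟨(i : ℕ) + 1, hi⟩ := by simp [Fin.lt_def]
  simp only at hs
  rw [hs, permWord_succ, add_lt_add_iff_right, ← Fin.lt_def, apply_succ_lt_iff hρ hlt,
    and_iff_right_iff_imp]
  rintro ⟨h, -⟩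
  rcases i with ⟨_ | j, hj⟩
  · simp [permWord]
  · have hp := permWord_succ ρ ⟨j, by omega⟩
    simp only at hp ⊢
    rw [hp, add_lt_add_iff_right, ← Fin.lt_def, ← not_le]
    intro hle
    have hjl : (⟨j, by omega⟩ : Fin (n + m)) < ⟨j + 1, hj⟩ := by simp [Fin.lt_def]
    have hlt' := lt_of_le_of_ne hle fun e => hjl.ne' (ρ.injective e)
    rw [((apply_succ_lt_iff hρ hjl).1 hlt').2] at h
    exact Bool.noConfusion h

theorem peakPlus_eq_descents {n m : ℕ} {ρ : Equiv.Perm (Fin (n + m))}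
    (hρ : ρ ∈ shuffles (1 : Equiv.Perm (Fin n)) (1 : Equiv.Perm (Fin m))) :
    peakPlus ρ = descents (shuffleWord n ρ) := by
  symm
  refine Finset.card_nbij (fun i => (i : ℕ) + 1) ?_ ?_ ?_
  · intro i hi
    simp only [Finset.mem_coe, Finset.mem_filter, Finset.mem_univ, true_and] at hi
    obtain ⟨h1, h, h2⟩ := hi
    simp only [augPeakSet, Finset.coe_filter, Set.mem_ofPred_eq, Finset.mem_Icc, Nat.add_sub_cancel]
    exact ⟨by omega, (permWord_peak_iff hρ i h).2 ⟨h1, h2⟩⟩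
  · intro i _ j _ h
    exact Fin.ext (Nat.succ_injective h)
  · intro k hk
    simp only [augPeakSet, Finset.coe_filter, Set.mem_ofPred_eq, Finset.mem_Icc] at hk
    obtain ⟨i, rfl⟩ : ∃ i, k = i + 1 := ⟨k - 1, by omega⟩
    have hi : i + 1 < n + m := by omega
    have := (permWord_peak_iff hρ ⟨i, by omega⟩ hi).1 hk.2
    refine ⟨⟨i, by omega⟩, ?_, rfl⟩
    simp only [Finset.mem_coe, Finset.mem_filter, Finset.mem_univ, true_and]
    exact ⟨this.1, hi, this.2⟩

theorem peakMinus_eq_interiorDescents {n m : ℕ} {ρ : Equiv.Perm (Fin (n + m))}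
    (hρ : ρ ∈ shuffles (1 : Equiv.Perm (Fin n)) (1 : Equiv.Perm (Fin m))) :
    peakMinus ρ = interiorDescents (shuffleWord n ρ) := by
  symm
  refine Finset.card_nbij (fun i => (i : ℕ) + 1) ?_ ?_ ?_
  · intro i hi
    simp only [Finset.mem_coe, Finset.mem_filter, Finset.mem_univ, true_and] at hi
    obtain ⟨h0, h1, h, h2⟩ := hi
    simp only [intPeakSet, Finset.coe_filter, Set.mem_ofPred_eq, Finset.mem_Icc, Nat.add_sub_cancel]
    exact ⟨by omega, by omega, (permWord_peak_iff hρ i h).2 ⟨h1, h2⟩⟩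
  · intro i _ j _ h
    exact Fin.ext (Nat.succ_injective h)
  · intro k hk
    simp only [intPeakSet, Finset.coe_filter, Set.mem_ofPred_eq, Finset.mem_Icc] at hk
    obtain ⟨i, rfl⟩ : ∃ i, k = i + 1 := ⟨k - 1, by omega⟩
    have hi : i + 1 < n + m := by omega
    have := (permWord_peak_iff hρ ⟨i, by omega⟩ hi).1 hk.2.2
    refine ⟨⟨i, by omega⟩, ?_, rfl⟩
    simp only [Finset.mem_coe, Finset.mem_filter, Finset.mem_univ, true_and]
    exact ⟨by simpa using hk.2.1, this.1, hi, this.2⟩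

theorem sum_shuffles_one_peakPlus (n m : ℕ) (φ : ℕ → ℚ) :
    ∑ ρ ∈ shuffles (1 : Equiv.Perm (Fin n)) (1 : Equiv.Perm (Fin m)), φ (peakPlus ρ)
      = chooseSum n m φ := by
  rw [← sum_binaryWords_descents, ← sum_shuffles_one n m fun f => φ (descents f)]
  exact Finset.sum_congr rfl fun ρ hρ => by rw [peakPlus_eq_descents hρ]

theorem sum_shuffles_one_peakMinus (n m : ℕ) (φ : ℕ → ℚ) :
    ∑ ρ ∈ shuffles (1 : Equiv.Perm (Fin n)) (1 : Equiv.Perm (Fin m)), φ (peakMinus ρ)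
      = if n = 0 then φ 0 else if m = 0 then φ 0 else
        chooseSum (n - 1) m φ + chooseSum n (m - 1) φ := by
  rw [← sum_binaryWords_interiorDescents rfl,
    ← sum_shuffles_one n m fun f => φ (interiorDescents f)]
  exact Finset.sum_congr rfl fun ρ hρ => by rw [peakMinus_eq_interiorDescents hρ]

theorem corollaryC (n m : ℕ) :
    (∑ σ ∈ shuffles (1 : Equiv.Perm (Fin n)) (1 : Equiv.Perm (Fin m)),
        (-1 : ℚ) ^ peakMinus σ * bivariateCatalan (peakMinus σ) ((n + m) / 2 - peakMinus σ)
      = if Odd n ∧ Odd m then 4 * bivariateCatalan 0 (n / 2) * bivariateCatalan 0 (m / 2)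
        else bivariateCatalan 0 (n / 2) * bivariateCatalan 0 (m / 2)) ∧
    (Even n → Even m →
      ∑ σ ∈ shuffles (1 : Equiv.Perm (Fin n)) (1 : Equiv.Perm (Fin m)),
        (-1 : ℚ) ^ peakPlus σ * bivariateCatalan (peakPlus σ) ((n + m) / 2 - peakPlus σ)
      = bivariateCatalan 0 (n / 2) * bivariateCatalan 0 (m / 2)) ∧
    (Odd n → Odd m →
      ∑ σ ∈ shuffles (1 : Equiv.Perm (Fin n)) (1 : Equiv.Perm (Fin m)),
        (-1 : ℚ) ^ peakPlus σ * bivariateCatalan (peakPlus σ) ((n + m) / 2 - peakPlus σ)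
      = 0) := by
  have hplus := sum_shuffles_one_peakPlus n m (catalanWeight ((n + m) / 2))
  have hminus := sum_shuffles_one_peakMinus n m (catalanWeight ((n + m) / 2))
  unfold catalanWeight at hplus hminus
  rw [hplus, hminus]
  change (ite _ (catalanWeight _ 0) (ite _ (catalanWeight _ 0)
      (chooseSum _ _ (catalanWeight _) + chooseSum _ _ (catalanWeight _))) = _) ∧
    (_ → _ → chooseSum _ _ (catalanWeight _) = _) ∧ (_ → _ → chooseSum _ _ (catalanWeight _) = _)
  refine ⟨?_, ?_, ?_⟩
  · rcases Nat.eq_zero_or_pos n with rfl | hn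
    · simp [catalanWeight, bivariateCatalan_zero_zero]
    rcases Nat.eq_zero_or_pos m with rfl | hm
    · simp [catalanWeight, bivariateCatalan_zero_zero, hn.ne']
    rw [if_neg hn.ne', if_neg hm.ne']
    rcases Nat.even_or_odd' n with ⟨p, rfl | rfl⟩ <;> rcases Nat.even_or_odd' m with ⟨q, rfl | rfl⟩
    -- Both even: the term of level `M` has odd arguments and vanishes, leaving the even product.
    · obtain ⟨p, rfl⟩ : ∃ r, p = r + 1 := ⟨p - 1, by omega⟩
      obtain ⟨q, rfl⟩ : ∃ r, q = r + 1 := ⟨q - 1, by omega⟩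
      have h := chooseSum_succ_add_chooseSum_succ (n := 2 * p + 1) (m := 2 * q + 1)
        (M := p + q + 1) (by ring)
      rw [chooseSum_catalanWeight_odd, show 2 * p + 1 + 1 = 2 * (p + 1) by ring,
        show 2 * q + 1 + 1 = 2 * (q + 1) by ring,
        show p + q + 1 + 1 = (p + 1) + (q + 1) by ring, chooseSum_catalanWeight_even] at h
      rw [if_neg (by simp [Nat.not_odd_iff_even]),
        show (2 * (p + 1) + 2 * (q + 1)) / 2 = p + 1 + (q + 1) by omega,
        show 2 * (p + 1) / 2 = p + 1 by omega, show 2 * (q + 1) / 2 = q + 1 by omega,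
        show 2 * (p + 1) - 1 = 2 * p + 1 by omega, show 2 * (q + 1) - 1 = 2 * q + 1 by omega]
      linear_combination h
    · obtain ⟨p, rfl⟩ : ∃ r, p = r + 1 := ⟨p - 1, by omega⟩
      have h1 := chooseSum_catalanWeight_odd p q
      have h2 := chooseSum_catalanWeight_even (p + 1) q
      rw [show p + 1 + q = p + q + 1 by ring] at h2
      rw [if_neg (by simp [Nat.not_odd_iff_even]),
        show (2 * (p + 1) + (2 * q + 1)) / 2 = p + q + 1 by omega,
        show 2 * (p + 1) / 2 = p + 1 by omega, show (2 * q + 1) / 2 = q by omega,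
        show 2 * (p + 1) - 1 = 2 * p + 1 by omega, Nat.add_sub_cancel, h1, h2, zero_add]
    · obtain ⟨q, rfl⟩ : ∃ r, q = r + 1 := ⟨q - 1, by omega⟩
      have h1 := chooseSum_catalanWeight_odd p q
      have h2 := chooseSum_catalanWeight_even p (q + 1)
      rw [← add_assoc] at h2
      rw [if_neg (by simp [Nat.not_odd_iff_even]),
        show (2 * p + 1 + 2 * (q + 1)) / 2 = p + q + 1 by omega,
        show 2 * (q + 1) / 2 = q + 1 by omega, show (2 * p + 1) / 2 = p by omega,
        show 2 * (q + 1) - 1 = 2 * q + 1 by omega, Nat.add_sub_cancel, h1, h2, add_zero]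
    -- Both odd: now the top term vanishes, and the even product of level `M` brings the factor `4`.
    · have h := chooseSum_succ_add_chooseSum_succ (n := 2 * p) (m := 2 * q)
        (M := p + q) (by ring)
      rw [chooseSum_catalanWeight_odd, chooseSum_catalanWeight_even] at h
      rw [if_pos (by simp),
        show (2 * p + 1 + (2 * q + 1)) / 2 = p + q + 1 by omega,
        show (2 * p + 1) / 2 = p by omega, show (2 * q + 1) / 2 = q by omega,
        Nat.add_sub_cancel, Nat.add_sub_cancel]
      linear_combination h
  · rintro ⟨p, rfl⟩ ⟨q, rfl⟩
    rw [← two_mul, ← two_mul, show (2 * p + 2 * q) / 2 = p + q by omega,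
      show 2 * p / 2 = p by omega, show 2 * q / 2 = q by omega]
    exact chooseSum_catalanWeight_even p q
  · rintro ⟨p, rfl⟩ ⟨q, rfl⟩
    rw [show (2 * p + 1 + (2 * q + 1)) / 2 = p + q + 1 by omega]
    exact chooseSum_catalanWeight_odd p q
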